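/- A real function is a function $f\colon\mathbb R\to\mathbb R$; it is identified with its graph $\{(x,f(x)) : x\in\mathbb R\}$, regarded as a subspace of the Euclidean plane $\mathbb R^2$. A family of subspaces of the plane is called incomparable if, whenever $X$ and $Y$ are members of the family (possibly $X=Y$) and $X$ is homeomorphic to a subspace $S$ of $Y$, then $X=S=Y$; in other words, distinct members are never homeomorphic, and no member is homeomorphic to a proper subspace of itself or of another member. Theorem 3. There exists a family of real functions of cardinality exactly $\mathfrak c=2^{\aleph_0}$ whose graphs are incomparable and such that each graph is connected and completely metrizable (equivalently, each graph is connected and a $G_\delta$-subset of $\mathbb R^2$). -/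

import Mathlib

/-- The graph `{(x, f x) | x ∈ ℝ}` of a real function, as a subset of the plane `ℝ × ℝ`. -/
def realGraph (f : ℝ → ℝ) : Set (ℝ × ℝ) := {p | p.2 = f p.1}

/-- A family of subspaces of a topological space is incomparable if a member `X` of the family is
homeomorphic to a subspace `S` of a member `Y` only in the trivial case `X = S = Y`. -/
def Incomparable {α : Type*} [TopologicalSpace α] (𝒳 : Set (Set α)) : Prop :=
  ∀ X ∈ 𝒳, ∀ Y ∈ 𝒳, ∀ S : Set α, S ⊆ Y → Nonempty (X ≃ₜ S) → X = S ∧ S = Y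

open Set Filter Topology

/-! ### Gδ subsets of Polish spaces -/

theorem IsGδ.isCompletelyMetrizableSpace {α : Type*} [TopologicalSpace α] [PolishSpace α]
    {s : Set α} (hs : IsGδ s) : TopologicalSpace.IsCompletelyMetrizableSpace s := by
  obtain ⟨U, hU, rfl⟩ := hs.eq_iInter_nat
  have hP : ∀ n, PolishSpace (U n) := fun n => (hU n).polishSpace
  -- The diagonal map identifies the intersection with a closed subset of the product of the Polish
  -- spaces `U n`.
  let e : (⋂ n, U n : Set α) → ∀ n, U n := fun x n => ⟨x, mem_iInter.1 x.2 n⟩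
  have he : Continuous e := by fun_prop
  have hind : IsEmbedding e := by
    refine IsEmbedding.of_comp he (g := fun z => (z 0 : α)) (by fun_prop) ?_
    exact IsEmbedding.subtypeVal
  have hrange : range e = {z | ∀ n, (z n : α) = z 0} := by
    ext z
    constructor
    · rintro ⟨x, rfl⟩ n
      rfl
    · intro hz
      refine ⟨⟨z 0, mem_iInter.2 fun n => hz n ▸ (z n).2⟩, ?_⟩
      funext n
      exact Subtype.ext (hz n).symm
  have hcl : IsClosed (range e) := by
    rw [hrange, ofPred_forall]
    exact isClosed_iInter fun n => isClosed_eq (by fun_prop) (by fun_prop)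
  exact IsClosedEmbedding.IsCompletelyMetrizableSpace ⟨hind, hcl⟩

/-! ### Monotone maps with order-connected range -/

section OneSided

variable {φ : ℝ → ℝ}

/-- A range without gaps contains all of `(φ x, φ (x + 1))`, so one-sided limits correspond under
`φ`. -/
theorem StrictMono.nhdsWithin_image_Ioi (hφ : StrictMono φ) (hc : OrdConnected (range φ)) (x : ℝ) :
    𝓝[φ '' Ioi x] (φ x) = 𝓝[>] (φ x) := by
  refine le_antisymm (nhdsWithin_mono _ (image_subset_iff.2 fun y hy => hφ hy))
    (nhdsWithin_le_of_mem (mem_of_superset (Ioo_mem_nhdsGT (hφ (lt_add_one x))) fun y hy => ?_))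
  obtain ⟨z, rfl⟩ := hc.out ⟨x, rfl⟩ ⟨x + 1, rfl⟩ (Ioo_subset_Icc_self hy)
  exact ⟨z, hφ.lt_iff_lt.1 hy.1, rfl⟩

theorem StrictMono.nhdsWithin_image_Iio (hφ : StrictMono φ) (hc : OrdConnected (range φ)) (x : ℝ) :
    𝓝[φ '' Iio x] (φ x) = 𝓝[<] (φ x) := by
  refine le_antisymm (nhdsWithin_mono _ (image_subset_iff.2 fun y hy => hφ hy))
    (nhdsWithin_le_of_mem (mem_of_superset (Ioo_mem_nhdsLT (hφ (sub_one_lt x))) fun y hy => ?_))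
  obtain ⟨z, rfl⟩ := hc.out ⟨x - 1, rfl⟩ ⟨x, rfl⟩ (Ioo_subset_Icc_self hy)
  exact ⟨z, hφ.lt_iff_lt.1 hy.2, rfl⟩

theorem StrictAnti.nhdsWithin_image_Ioi (hφ : StrictAnti φ) (hc : OrdConnected (range φ)) (x : ℝ) :
    𝓝[φ '' Ioi x] (φ x) = 𝓝[<] (φ x) := by
  refine le_antisymm (nhdsWithin_mono _ (image_subset_iff.2 fun y hy => hφ hy))
    (nhdsWithin_le_of_mem (mem_of_superset (Ioo_mem_nhdsLT (hφ (lt_add_one x))) fun y hy => ?_))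
  obtain ⟨z, rfl⟩ := hc.out ⟨x + 1, rfl⟩ ⟨x, rfl⟩ (Ioo_subset_Icc_self hy)
  exact ⟨z, hφ.lt_iff_gt.1 hy.2, rfl⟩

theorem StrictAnti.nhdsWithin_image_Iio (hφ : StrictAnti φ) (hc : OrdConnected (range φ)) (x : ℝ) :
    𝓝[φ '' Iio x] (φ x) = 𝓝[>] (φ x) := by
  refine le_antisymm (nhdsWithin_mono _ (image_subset_iff.2 fun y hy => hφ hy))
    (nhdsWithin_le_of_mem (mem_of_superset (Ioo_mem_nhdsGT (hφ (sub_one_lt x))) fun y hy => ?_))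
  obtain ⟨z, rfl⟩ := hc.out ⟨x, rfl⟩ ⟨x - 1, rfl⟩ (Ioo_subset_Icc_self hy)
  exact ⟨z, hφ.lt_iff_gt.1 hy.1, rfl⟩

theorem StrictAnti.isEmbedding_of_ordConnected_range (hφ : StrictAnti φ)
    (hc : OrdConnected (range φ)) : IsEmbedding φ := by
  have hm : StrictMono fun x => -φ x := fun x y hxy => neg_lt_neg (hφ hxy)
  have hr : OrdConnected (range fun x => -φ x) := by
    refine ⟨?_⟩
    rintro _ ⟨a, rfl⟩ _ ⟨b, rfl⟩ y hy
    obtain ⟨z, hz⟩ := hc.out ⟨b, rfl⟩ ⟨a, rfl⟩ (show -y ∈ Icc (φ b) (φ a) from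
      ⟨by linarith [hy.2], by linarith [hy.1]⟩)
    exact ⟨z, by simp [hz]⟩
  have := (Homeomorph.neg ℝ).isEmbedding.comp (hm.isEmbedding_of_ordConnected hr)
  convert this using 1
  funext x
  simp

/-- An injective real function that maps closed intervals to intervals is strictly monotone. -/
theorem strictMono_or_strictAnti_of_ordConnected_image (hinj : Function.Injective φ)
    (h : ∀ a b, OrdConnected (φ '' Icc a b)) : StrictMono φ ∨ StrictAnti φ := by
  have key : Monotone φ ∨ Antitone φ := by
    by_contra hcon
    rw [not_or, not_monotone_not_antitone_iff_exists_lt_lt] at hcon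
    obtain ⟨a, b, c, hab, hbc, hφ⟩ := hcon
    -- `φ b` lies strictly above or below both outer values. Whichever of `φ a`, `φ c` is nearer to
    -- `φ b` is then attained on the interval between `b` and the other point, against injectivity.
    have hleft : φ a ∉ φ '' Icc b c := by
      rw [hinj.mem_set_image]
      exact fun hm => hab.not_ge hm.1
    have hright : φ c ∉ φ '' Icc a b := by
      rw [hinj.mem_set_image]
      exact fun hm => hbc.not_ge hm.2
    have hma := mem_image_of_mem φ (left_mem_Icc.2 hab.le)
    have hmb := mem_image_of_mem φ (right_mem_Icc.2 hab.le)
    have hmb' := mem_image_of_mem φ (left_mem_Icc.2 hbc.le)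
    have hmc := mem_image_of_mem φ (right_mem_Icc.2 hbc.le)
    rcases hφ with ⟨h1, h2⟩ | ⟨h1, h2⟩ <;> rcases le_total (φ a) (φ c) with h3 | h3
    · exact hright ((h a b).out hma hmb ⟨h3, h2.le⟩)
    · exact hleft ((h b c).out hmc hmb' ⟨h3, h1.le⟩)
    · exact hleft ((h b c).out hmb' hmc ⟨h1.le, h3⟩)
    · exact hright ((h a b).out hmb hma ⟨h2.le, h3⟩)
  exact key.imp (fun hm => hm.strictMono_of_injective hinj)
    (fun hm => hm.strictAnti_of_injective hinj)

end OneSided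

/-! ### Embeddings between graphs -/

/-- The parametrization of the graph of a real function by the real line. -/
def graphMap (f : ℝ → ℝ) (x : ℝ) : ℝ × ℝ := (x, f x)

theorem range_graphMap (f : ℝ → ℝ) : range (graphMap f) = realGraph f := by
  ext ⟨x, y⟩
  simp [graphMap, realGraph, eq_comm]

theorem continuousWithinAt_graphMap_iff {f : ℝ → ℝ} {s : Set ℝ} {x : ℝ} :
    ContinuousWithinAt (graphMap f) s x ↔ ContinuousWithinAt f s x :=
  ⟨fun h => h.snd, fun h => continuousWithinAt_id.prodMk h⟩

/-- The map of the line induced by an embedding of the graph of `f` into the graph of `g`. -/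
theorem exists_parameter_map {f g : ℝ → ℝ} {S : Set (ℝ × ℝ)} (hS : S ⊆ realGraph g)
    (h : realGraph f ≃ₜ S) (hf : ∀ a b, IsPreconnected (graphMap f '' Icc a b))
    (hf' : IsPreconnected (realGraph f)) :
    ∃ φ : ℝ → ℝ, (StrictMono φ ∨ StrictAnti φ) ∧ OrdConnected (range φ) ∧
      graphMap g '' range φ = S ∧
      ∀ s x, ContinuousWithinAt f s x ↔ ContinuousWithinAt g (φ '' s) (φ x) := by
  let j : ℝ → realGraph f := fun x => ⟨graphMap f x, rfl⟩
  let H : ℝ → ℝ × ℝ := fun x => h (j x)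
  let φ : ℝ → ℝ := fun x => (H x).1
  have hH : graphMap g ∘ φ = H := by
    funext x
    exact Prod.ext rfl (hS (h (j x)).2).symm
  have hjsurj : Function.Surjective j := by
    rintro ⟨⟨x, y⟩, hxy⟩
    exact ⟨x, Subtype.ext (Prod.ext rfl (Eq.symm hxy))⟩
  have hinj : Function.Injective φ := by
    intro x y hxy
    have h1 : H x = H y := by rw [← hH]; exact congrArg (graphMap g) hxy
    have h2 : j x = j y := h.injective (Subtype.ext h1)
    exact congrArg (fun p : realGraph f => (p : ℝ × ℝ).1) h2
  have hcont : Continuous fun p : realGraph f => ((h p : S) : ℝ × ℝ).1 := by fun_prop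
  have himg : ∀ a b, OrdConnected (φ '' Icc a b) := by
    intro a b
    have h1 : IsPreconnected (j '' Icc a b) := by
      rw [← IsInducing.subtypeVal.isPreconnected_image, image_image]
      exact hf a b
    have h2 := h1.image _ hcont.continuousOn
    rw [image_image] at h2
    exact h2.ordConnected
  have hrange : OrdConnected (range φ) := by
    have h1 : IsPreconnected (univ : Set (realGraph f)) := by
      rw [← IsInducing.subtypeVal.isPreconnected_image]
      simpa using hf'
    have h2 := (h1.image _ hcont.continuousOn).ordConnected
    rw [← hjsurj.range_eq, ← range_comp] at h2
    exact h2
  have hmono := strictMono_or_strictAnti_of_ordConnected_image hinj himg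
  have hemb : IsEmbedding φ := hmono.elim (fun hm => hm.isEmbedding_of_ordConnected hrange)
    (fun hm => hm.isEmbedding_of_ordConnected_range hrange)
  refine ⟨φ, hmono, hrange, ?_, fun s x => ?_⟩
  · rw [← range_comp, hH]
    have : H = (Subtype.val ∘ h) ∘ j := rfl
    rw [this, hjsurj.range_comp, h.surjective.range_comp, Subtype.range_coe]
  · rw [← continuousWithinAt_graphMap_iff, ← continuousWithinAt_graphMap_iff (f := g)]
    -- `h` is an embedding, so it neither creates nor destroys continuity of the parametrization.
    have h1 : ContinuousWithinAt (graphMap f) s x ↔ ContinuousWithinAt H s x := by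
      rw [show graphMap f = Subtype.val ∘ j from rfl,
        show H = (Subtype.val ∘ h) ∘ j from rfl,
        ← IsInducing.subtypeVal.continuousWithinAt_iff,
        ← (IsInducing.subtypeVal.comp h.isInducing).continuousWithinAt_iff]
    rw [h1, ← hH, ContinuousWithinAt, ContinuousWithinAt, ← hemb.map_nhdsWithin_eq,
      tendsto_map'_iff]
    rfl

/-! ### The oscillating functions -/

open Classical in
/-- A function that oscillates on the right of every integer, and on the left of exactly the
integers in `A`; it vanishes at the integers and is continuous elsewhere. -/
noncomputable def oscillating (A : Set ℤ) (x : ℝ) : ℝ :=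
  Real.sin (Real.pi / if ⌊x⌋ + 1 ∈ A then min (Int.fract x) (1 - Int.fract x) else Int.fract x)

section Oscillating

variable (A : Set ℤ)

theorem oscillating_intCast (n : ℤ) : oscillating A n = 0 := by
  simp [oscillating]

open Classical in
theorem oscillating_eq_of_mem_Icc {n : ℤ} {x : ℝ} (hx : x ∈ Icc (n : ℝ) (n + 1)) :
    oscillating A x =
      Real.sin (Real.pi / if n + 1 ∈ A then min (x - n) (n + 1 - x) else x - n) := by
  rcases hx.2.lt_or_eq with hlt | rfl
  · have hfl : ⌊x⌋ = n := Int.floor_eq_iff.2 ⟨hx.1, hlt⟩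
    rw [oscillating, Int.fract, hfl]
    congr 4
    ring
  -- At the right endpoint both formulas vanish: one is `sin π`, the other uses `π / 0 = 0`.
  · have := oscillating_intCast A (n + 1)
    push_cast at this
    rw [this]
    split_ifs <;> simp

theorem continuousOn_oscillating (n : ℤ) : ContinuousOn (oscillating A) (Ioo (n : ℝ) (n + 1)) := by
  classical
  refine ContinuousOn.congr ?_ fun x hx => oscillating_eq_of_mem_Icc A (Ioo_subset_Icc_self hx)
  refine Real.continuous_sin.comp_continuousOn (continuousOn_const.div ?_ fun x hx => ?_)
  · split_ifs <;> fun_prop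
  · have h1 : 0 < x - n := sub_pos.2 hx.1
    have h2 : 0 < n + 1 - x := sub_pos.2 hx.2
    split_ifs
    · exact (lt_min h1 h2).ne'
    · exact h1.ne'

theorem continuousAt_oscillating {x : ℝ} (hx : x ∉ range ((↑) : ℤ → ℝ)) :
    ContinuousAt (oscillating A) x := by
  refine (continuousOn_oscillating A ⌊x⌋).continuousAt (Ioo_mem_nhds ?_ (Int.lt_floor_add_one x))
  exact (Int.floor_le x).lt_of_ne fun h => hx ⟨_, h⟩

theorem oscillating_eventuallyEq_right (n : ℤ) :
    oscillating A =ᶠ[𝓝[>] (n : ℝ)] fun x => Real.sin (Real.pi / (x - n)) := by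
  filter_upwards [Ioo_mem_nhdsGT (show (n : ℝ) < n + 1 / 2 by norm_num)] with x hx
  rw [oscillating_eq_of_mem_Icc A ⟨hx.1.le, by linarith [hx.2]⟩, min_eq_left (by linarith [hx.2]),
    ite_self]

theorem oscillating_eventuallyEq_left {n : ℤ} (hn : n ∈ A) :
    oscillating A =ᶠ[𝓝[<] (n : ℝ)] fun x => Real.sin (Real.pi / (n - x)) := by
  filter_upwards [Ioo_mem_nhdsLT (show (n : ℝ) - 1 / 2 < n by norm_num)] with x hx
  rw [oscillating_eq_of_mem_Icc A (n := n - 1)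
      ⟨by push_cast; linarith [hx.1], by push_cast; linarith [hx.2]⟩,
    if_pos (by simpa using hn), min_eq_right (by push_cast; linarith [hx.1])]
  push_cast
  ring_nf

theorem continuousWithinAt_oscillating_left {n : ℤ} (hn : n ∉ A) :
    ContinuousWithinAt (oscillating A) (Iio n) n := by
  have h : ContinuousAt (fun x : ℝ => Real.sin (Real.pi / (x - (n - 1)))) n :=
    Real.continuous_sin.continuousAt.comp
      (continuousAt_const.div (by fun_prop) (by norm_num))
  refine h.continuousWithinAt.congr_of_eventuallyEq ?_ ?_
  · filter_upwards [Ioo_mem_nhdsLT (show (n : ℝ) - 1 < n by norm_num)] with x hx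
    rw [oscillating_eq_of_mem_Icc A (n := n - 1)
        ⟨by push_cast; linarith [hx.1], by push_cast; linarith [hx.2]⟩,
      if_neg (by simpa using hn)]
    push_cast
    rfl
  · rw [oscillating_intCast]
    norm_num

theorem frequently_sin_pi_div_eq_zero : ∃ᶠ t in 𝓝[>] (0 : ℝ), Real.sin (Real.pi / t) = 0 := by
  have h : Tendsto (fun k : ℕ => ((k : ℝ) + 1)⁻¹) atTop (𝓝[>] 0) :=
    tendsto_inv_atTop_nhdsGT_zero.comp
      (tendsto_natCast_atTop_atTop.atTop_add tendsto_const_nhds)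
  refine h.frequently (Frequently.of_forall fun k => ?_)
  rw [div_inv_eq_mul, mul_comm]
  exact_mod_cast Real.sin_nat_mul_pi (k + 1)

theorem frequently_sin_pi_div_eq_one : ∃ᶠ t in 𝓝[>] (0 : ℝ), Real.sin (Real.pi / t) = 1 := by
  have h : Tendsto (fun k : ℕ => ((k : ℝ) * 2 + 1 / 2)⁻¹) atTop (𝓝[>] 0) :=
    tendsto_inv_atTop_nhdsGT_zero.comp
      ((tendsto_natCast_atTop_atTop.atTop_mul_const two_pos).atTop_add tendsto_const_nhds)
  refine h.frequently (Frequently.of_forall fun k => ?_)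
  rw [div_inv_eq_mul, show Real.pi * ((k : ℝ) * 2 + 1 / 2) = Real.pi / 2 + k * (2 * Real.pi) by ring,
    Real.sin_add_nat_mul_two_pi, Real.sin_pi_div_two]

theorem tendsto_add_nhdsGT_zero (a : ℝ) : Tendsto (fun t => a + t) (𝓝[>] 0) (𝓝[>] a) := by
  refine tendsto_nhdsWithin_of_tendsto_nhds_of_eventually_within _ ?_ ?_
  · have : Tendsto (fun t => a + t) (𝓝 0) (𝓝 (a + 0)) := (continuous_const_add a).tendsto 0
    rw [add_zero] at this
    exact this.mono_left nhdsWithin_le_nhds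
  · filter_upwards [self_mem_nhdsWithin] with t ht
    exact lt_add_of_pos_right a ht

theorem tendsto_sub_nhdsGT_zero (a : ℝ) : Tendsto (fun t => a - t) (𝓝[>] 0) (𝓝[<] a) := by
  refine tendsto_nhdsWithin_of_tendsto_nhds_of_eventually_within _ ?_ ?_
  · have : Tendsto (fun t => a - t) (𝓝 0) (𝓝 (a - 0)) := (continuous_sub_left a).tendsto 0
    rw [sub_zero] at this
    exact this.mono_left nhdsWithin_le_nhds
  · filter_upwards [self_mem_nhdsWithin] with t ht
    exact sub_lt_self a ht

theorem frequently_oscillating_right {c : ℝ}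
    (hc : ∃ᶠ t in 𝓝[>] (0 : ℝ), Real.sin (Real.pi / t) = c) (n : ℤ) :
    ∃ᶠ x in 𝓝[>] (n : ℝ), oscillating A x = c := by
  have h : ∃ᶠ x in 𝓝[>] (n : ℝ), Real.sin (Real.pi / (x - n)) = c :=
    (tendsto_add_nhdsGT_zero _).frequently (by simpa using hc)
  exact (h.and_eventually (oscillating_eventuallyEq_right A n)).mono fun x hx => hx.2.trans hx.1

theorem frequently_oscillating_left {c : ℝ}
    (hc : ∃ᶠ t in 𝓝[>] (0 : ℝ), Real.sin (Real.pi / t) = c) {n : ℤ} (hn : n ∈ A) :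
    ∃ᶠ x in 𝓝[<] (n : ℝ), oscillating A x = c := by
  have h : ∃ᶠ x in 𝓝[<] (n : ℝ), Real.sin (Real.pi / (n - x)) = c :=
    (tendsto_sub_nhdsGT_zero _).frequently (by simpa using hc)
  exact (h.and_eventually (oscillating_eventuallyEq_left A hn)).mono fun x hx => hx.2.trans hx.1

theorem not_continuousWithinAt_of_frequently_eq_one {n : ℤ} {s : Set ℝ}
    (h : ∃ᶠ x in 𝓝[s] (n : ℝ), oscillating A x = 1) :
    ¬ ContinuousWithinAt (oscillating A) s n := by
  intro hc
  rw [ContinuousWithinAt, oscillating_intCast] at hc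
  obtain ⟨x, hx1, hx2⟩ := (h.and_eventually (hc.eventually (gt_mem_nhds one_pos))).exists
  exact hx2.ne hx1

theorem continuousWithinAt_oscillating_Ioi_iff {x : ℝ} :
    ContinuousWithinAt (oscillating A) (Ioi x) x ↔ x ∉ range ((↑) : ℤ → ℝ) := by
  refine ⟨?_, fun hx => (continuousAt_oscillating A hx).continuousWithinAt⟩
  rintro hc ⟨n, rfl⟩
  exact not_continuousWithinAt_of_frequently_eq_one A
    (frequently_oscillating_right A frequently_sin_pi_div_eq_one n) hc

theorem continuousWithinAt_oscillating_Iio_iff {n : ℤ} :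
    ContinuousWithinAt (oscillating A) (Iio n) n ↔ n ∉ A :=
  ⟨fun hc hn => not_continuousWithinAt_of_frequently_eq_one A
    (frequently_oscillating_left A frequently_sin_pi_div_eq_one hn) hc,
    continuousWithinAt_oscillating_left A⟩

/-- The zeros accumulating at `n` keep `(n, 0)` in the closure of the adjacent arc despite the
discontinuity. -/
theorem mapClusterPt_graphMap_right (n : ℤ) :
    MapClusterPt (graphMap (oscillating A) n) (𝓝[>] (n : ℝ)) (graphMap (oscillating A)) := by
  rw [mapClusterPt_iff_frequently]
  intro s hs
  have hc : Tendsto (fun x : ℝ => (x, (0 : ℝ))) (𝓝[>] (n : ℝ)) (𝓝 ((n : ℝ), 0)) :=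
    Tendsto.mono_left (Continuous.tendsto (by fun_prop) _) nhdsWithin_le_nhds
  rw [graphMap, oscillating_intCast] at hs
  refine ((frequently_oscillating_right A frequently_sin_pi_div_eq_zero n).and_eventually
    (hc.eventually hs)).mono fun x hx => ?_
  rw [graphMap, hx.1]
  exact hx.2

theorem mapClusterPt_graphMap_left (n : ℤ) :
    MapClusterPt (graphMap (oscillating A) n) (𝓝[<] (n : ℝ)) (graphMap (oscillating A)) := by
  by_cases hn : n ∈ A
  · rw [mapClusterPt_iff_frequently]
    intro s hs
    have hc : Tendsto (fun x : ℝ => (x, (0 : ℝ))) (𝓝[<] (n : ℝ)) (𝓝 ((n : ℝ), 0)) :=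
      Tendsto.mono_left (Continuous.tendsto (by fun_prop) _) nhdsWithin_le_nhds
    rw [graphMap, oscillating_intCast] at hs
    refine ((frequently_oscillating_left A frequently_sin_pi_div_eq_zero hn).and_eventually
      (hc.eventually hs)).mono fun x hx => ?_
    rw [graphMap, hx.1]
    exact hx.2
  · exact (continuousWithinAt_graphMap_iff.2
      (continuousWithinAt_oscillating_left A hn)).tendsto.mapClusterPt

theorem MapClusterPt.mem_closure_image {α β : Type*} [TopologicalSpace β] {F : Filter α}
    {u : α → β} {y : β} (h : MapClusterPt y F u) {s : Set α} (hs : s ∈ F) :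
    y ∈ closure (u '' s) := by
  rw [mem_closure_iff_clusterPt]
  exact ClusterPt.mono h (le_principal_iff.2 (image_mem_map hs))

theorem isPreconnected_graphMap_image_inter_Icc {s : Set ℝ} (hs : OrdConnected s) (n : ℤ) :
    IsPreconnected (graphMap (oscillating A) '' (s ∩ Icc (n : ℝ) (n + 1))) := by
  by_cases hsub : (s ∩ Icc (n : ℝ) (n + 1)).Subsingleton
  · exact (hsub.image _).isPreconnected
  have hpre : IsPreconnected (graphMap (oscillating A) '' (s ∩ Ioo (n : ℝ) (n + 1))) := by
    refine (hs.inter ordConnected_Ioo).isPreconnected.image _ fun x hx => ?_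
    exact continuousWithinAt_graphMap_iff.2
      ((continuousOn_oscillating A n x hx.2).mono inter_subset_right)
  obtain ⟨a, ha, b, hb, hab⟩ : ∃ a ∈ s ∩ Icc (n : ℝ) (n + 1), ∃ b ∈ s ∩ Icc (n : ℝ) (n + 1),
      a < b := by
    rw [not_subsingleton_iff] at hsub
    exact hsub.exists_lt
  -- The piece lies between the connected arc over the open interval and its closure.
  refine hpre.subset_closure (image_mono (inter_subset_inter_right s Ioo_subset_Icc_self)) ?_
  rintro _ ⟨x, hx, rfl⟩
  rcases hx.2.1.eq_or_lt with rfl | h1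
  · refine (mapClusterPt_graphMap_right A n).mem_closure_image ?_
    have hnb : (n : ℝ) < b := ha.2.1.trans_lt hab
    filter_upwards [Ioo_mem_nhdsGT hnb] with y hy
    exact ⟨hs.out hx.1 hb.1 (Ioo_subset_Icc_self hy), hy.1, hy.2.trans_le hb.2.2⟩
  rcases hx.2.2.eq_or_lt with rfl | h2
  · have hcl := mapClusterPt_graphMap_left A (n + 1)
    push_cast at hcl
    refine hcl.mem_closure_image ?_
    have hna : a < (n : ℝ) + 1 := hab.trans_le hb.2.2
    filter_upwards [Ioo_mem_nhdsLT hna] with y hy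
    exact ⟨hs.out ha.1 hx.1 (Ioo_subset_Icc_self hy), ha.2.1.trans_lt hy.1, hy.2⟩
  · exact subset_closure ⟨x, ⟨hx.1, h1, h2⟩, rfl⟩

theorem isPreconnected_graphMap_image_Icc (a b : ℝ) :
    IsPreconnected (graphMap (oscillating A) '' Icc a b) := by
  have hcover : ⋃ n ∈ Icc ⌊a⌋ ⌊b⌋, Icc a b ∩ Icc (n : ℝ) (n + 1) = Icc a b := by
    refine Subset.antisymm (iUnion₂_subset fun _ _ => inter_subset_left) fun x hx => ?_
    exact mem_iUnion₂.2 ⟨⌊x⌋, ⟨Int.floor_mono hx.1, Int.floor_mono hx.2⟩, hx, Int.floor_le x,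
      (Int.lt_floor_add_one x).le⟩
  rw [← hcover, image_iUnion₂]
  -- Consecutive pieces share the point over `n + 1`.
  refine IsPreconnected.biUnion_of_chain ordConnected_Icc
    (fun n _ => isPreconnected_graphMap_image_inter_Icc A ordConnected_Icc n) fun n hn hn' => ?_
  rw [Order.succ_eq_add_one] at hn' ⊢
  have h0 : (⌊a⌋ : ℝ) ≤ n := by exact_mod_cast hn.1
  have h1 : a ≤ (n : ℝ) + 1 := (Int.lt_floor_add_one a).le.trans (by linarith)
  have h2 : (n : ℝ) + 1 ≤ b := by exact_mod_cast Int.le_floor.1 hn'.2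
  refine ⟨graphMap (oscillating A) (n + 1), mem_image_of_mem _ ⟨⟨h1, h2⟩, ?_⟩,
    mem_image_of_mem _ ⟨⟨h1, h2⟩, ?_⟩⟩ <;> constructor <;> push_cast <;> linarith

theorem isConnected_realGraph_oscillating : IsConnected (realGraph (oscillating A)) := by
  refine ⟨⟨(0, oscillating A 0), rfl⟩, ?_⟩
  rw [← range_graphMap]
  refine isPreconnected_of_forall_pair ?_
  rintro _ ⟨a, rfl⟩ _ ⟨b, rfl⟩
  exact ⟨graphMap (oscillating A) '' Icc (min a b) (max a b), image_subset_range _ _,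
    mem_image_of_mem _ ⟨min_le_left _ _, le_max_left _ _⟩,
    mem_image_of_mem _ ⟨min_le_right _ _, le_max_right _ _⟩,
    isPreconnected_graphMap_image_Icc A _ _⟩

theorem isGδ_realGraph_oscillating : IsGδ (realGraph (oscillating A)) := by
  let Z : Set ℝ := range ((↑) : ℤ → ℝ)
  have hZ : IsClosed Z := Int.isClosedEmbedding_coe_real.isClosed_range
  have hfst : IsOpen {p : ℝ × ℝ | p.1 ∈ Zᶜ} := hZ.isOpen_compl.preimage continuous_fst
  have hopen : IsOpen {p : ℝ × ℝ | p.1 ∈ Zᶜ ∧ p.2 ≠ oscillating A p.1} := by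
    have hc : ContinuousOn (fun p : ℝ × ℝ => p.2 - oscillating A p.1) {p : ℝ × ℝ | p.1 ∈ Zᶜ} :=
      continuous_snd.continuousOn.sub fun p hp =>
        ((continuousAt_oscillating A hp).comp continuousAt_fst).continuousWithinAt
    have := hc.isOpen_inter_preimage hfst isOpen_compl_singleton (t := {(0 : ℝ)}ᶜ)
    convert this using 1
    ext p
    simp [sub_eq_zero]
  have hcl : IsClosed {p : ℝ × ℝ | p.1 ∈ Z ∧ p.2 = 0} :=
    (hZ.preimage continuous_fst).inter (isClosed_eq continuous_snd continuous_const)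
  -- Over the integers the graph is closed; over their open complement it is relatively closed.
  have heq : realGraph (oscillating A) = {p : ℝ × ℝ | p.1 ∈ Z ∧ p.2 = 0} ∪
      ({p : ℝ × ℝ | p.1 ∈ Zᶜ} ∩ {p : ℝ × ℝ | p.1 ∈ Zᶜ ∧ p.2 ≠ oscillating A p.1}ᶜ) := by
    ext ⟨x, y⟩
    by_cases hx : x ∈ Z
    · obtain ⟨n, rfl⟩ := hx
      simp [realGraph, oscillating_intCast, Z]
    · simp [realGraph, hx]
  rw [heq]
  exact hcl.isGδ.union (hfst.isGδ.inter hopen.isClosed_compl.isGδ)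

end Oscillating

/-! ### Rigidity -/

/-- An embedding between graphs of oscillating functions shifts the integers. -/
theorem exists_shift_of_homeomorph {A B : Set ℤ} (hA : A ≠ univ) {S : Set (ℝ × ℝ)}
    (hS : S ⊆ realGraph (oscillating B)) (h : realGraph (oscillating A) ≃ₜ S) :
    S = realGraph (oscillating B) ∧ ∃ k : ℤ, ∀ n, n ∈ A ↔ n + k ∈ B := by
  obtain ⟨φ, hmono, hr, hφS, hφ⟩ := exists_parameter_map hS h
    (isPreconnected_graphMap_image_Icc A) (isConnected_realGraph_oscillating A).isPreconnected
  rcases hmono with hm | hm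
  · have hR : ∀ x, ContinuousWithinAt (oscillating A) (Ioi x) x ↔
        ContinuousWithinAt (oscillating B) (Ioi (φ x)) (φ x) := fun x => by
      rw [hφ, ContinuousWithinAt, hm.nhdsWithin_image_Ioi hr, ContinuousWithinAt]
    have hL : ∀ x, ContinuousWithinAt (oscillating A) (Iio x) x ↔
        ContinuousWithinAt (oscillating B) (Iio (φ x)) (φ x) := fun x => by
      rw [hφ, ContinuousWithinAt, hm.nhdsWithin_image_Iio hr, ContinuousWithinAt]
    -- Integers are exactly the points of right discontinuity of either function.
    have hint : ∀ x, x ∈ range ((↑) : ℤ → ℝ) ↔ φ x ∈ range ((↑) : ℤ → ℝ) := fun x => by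
      have := hR x
      rw [continuousWithinAt_oscillating_Ioi_iff, continuousWithinAt_oscillating_Ioi_iff] at this
      exact not_iff_not.1 this
    choose k hk using fun n : ℤ => (hint n).1 ⟨n, rfl⟩
    have hkm : StrictMono k := fun m n hmn => by
      have : φ m < φ n := hm (by exact_mod_cast hmn)
      rw [← hk, ← hk] at this
      exact_mod_cast this
    -- A strictly increasing integer sequence is unbounded both ways, and the range has no gaps.
    have huniv : range φ = univ := by
      refine eq_univ_of_forall fun y => ?_
      obtain ⟨_, ⟨a, rfl⟩, ha⟩ :=
        not_bddAbove_iff.1 hkm.not_bddAbove_range_of_isSuccArchimedean ⌈y⌉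
      obtain ⟨_, ⟨b, rfl⟩, hb⟩ :=
        not_bddBelow_iff.1 hkm.not_bddBelow_range_of_isPredArchimedean ⌊y⌋
      refine hr.out ⟨b, rfl⟩ ⟨a, rfl⟩ ⟨?_, ?_⟩
      · rw [← hk]
        exact Int.le_floor.1 hb.le
      · rw [← hk]
        exact Int.ceil_le.1 ha.le
    have hksurj : Function.Surjective k := by
      intro m
      obtain ⟨x, hx⟩ : (m : ℝ) ∈ range φ := huniv ▸ mem_univ _
      obtain ⟨n, rfl⟩ := (hint x).2 ⟨m, hx.symm⟩
      exact ⟨n, by exact_mod_cast (hk n).trans hx⟩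
    have hsucc : ∀ n, k (n + 1) = k n + 1 := fun n => by
      simpa [Order.succ_eq_add_one] using (hkm.orderIsoOfSurjective k hksurj).map_succ n
    have hshift : ∀ n, k n = n + k 0 := fun n => by
      induction n using Int.induction_on with
      | zero => simp
      | succ i ih => rw [hsucc, ih]; ring
      | pred i ih =>
        have := hsucc (-i - 1)
        rw [sub_add_cancel, ih] at this
        linarith
    refine ⟨?_, k 0, fun n => ?_⟩
    · rw [← hφS, huniv, image_univ, range_graphMap]
    · have := hL n
      rw [continuousWithinAt_oscillating_Iio_iff, ← hk, continuousWithinAt_oscillating_Iio_iff,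
        not_iff_not, hshift] at this
      exact this
  · exfalso
    -- Left continuity at `n` becomes right continuity at `φ n`, so `φ n` is not an integer. Full
    -- continuity there pulls back to right continuity at `n`, which fails.
    obtain ⟨n, hn⟩ := (ne_univ_iff_exists_notMem A).1 hA
    have h1 := (hφ (Iio n) n).1 (continuousWithinAt_oscillating_left A hn)
    rw [ContinuousWithinAt, hm.nhdsWithin_image_Iio hr] at h1
    have h2 := (continuousWithinAt_oscillating_Ioi_iff B).1 h1
    refine (continuousWithinAt_oscillating_Ioi_iff A (x := n)).1 ?_ ⟨n, rfl⟩
    rw [hφ, ContinuousWithinAt, hm.nhdsWithin_image_Ioi hr]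
    exact (continuousAt_oscillating B h2).continuousWithinAt

/-- A set of integers with least element `0` that codes a set of natural numbers. -/
def integerCode (B : Set ℕ) : Set ℤ := insert 0 ((fun n : ℕ => (n : ℤ) + 1) '' B)

theorem isLeast_integerCode (B : Set ℕ) : IsLeast (integerCode B) 0 := by
  refine ⟨mem_insert _ _, ?_⟩
  rintro _ (rfl | ⟨n, -, rfl⟩)
  · exact le_rfl
  · positivity

theorem integerCode_ne_univ (B : Set ℕ) : integerCode B ≠ univ := fun h => by
  have := (isLeast_integerCode B).2 (h ▸ mem_univ (-1))
  omega

theorem integerCode_injective : Function.Injective integerCode := by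
  have key : ∀ (B : Set ℕ) (n : ℕ), (n : ℤ) + 1 ∈ integerCode B ↔ n ∈ B := fun B n => by
    simp only [integerCode, mem_insert_iff, mem_image]
    constructor
    · rintro (h | ⟨m, hm, h⟩)
      · omega
      · obtain rfl : m = n := by omega
        exact hm
    · exact fun h => Or.inr ⟨n, h, rfl⟩
  intro B C h
  ext n
  rw [← key, h, key]

theorem oscillating_injective : Function.Injective oscillating := by
  intro A B h
  ext n
  rw [← not_iff_not, ← continuousWithinAt_oscillating_Iio_iff, h,
    continuousWithinAt_oscillating_Iio_iff]

/-- Comparing least elements in both directions gives `k ≥ 0` and `k ≤ 0`. -/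
theorem eq_of_isLeast_of_shift {A B : Set ℤ} {a k : ℤ} (hA : IsLeast A a) (hB : IsLeast B a)
    (h : ∀ n, n ∈ A ↔ n + k ∈ B) : A = B := by
  have h1 := hB.2 ((h a).1 hA.1)
  have h2 := hA.2 ((h (a - k)).2 (by simpa using hB.1))
  obtain rfl : k = 0 := by omega
  ext n
  simpa using h n

theorem theorem3 :
    ∃ 𝓕 : Set (ℝ → ℝ),
      Cardinal.mk 𝓕 = Cardinal.continuum ∧
      Incomparable (realGraph '' 𝓕) ∧
      ∀ f ∈ 𝓕, IsConnected (realGraph f) ∧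
        TopologicalSpace.IsCompletelyMetrizableSpace (realGraph f) ∧
        IsGδ (realGraph f) := by
  refine ⟨range (oscillating ∘ integerCode), ?_, ?_, ?_⟩
  · rw [Cardinal.mk_range_eq _ (oscillating_injective.comp integerCode_injective)]
    simp
  · rintro _ ⟨_, ⟨B, rfl⟩, rfl⟩ _ ⟨_, ⟨C, rfl⟩, rfl⟩ S hS ⟨h⟩
    obtain ⟨hSC, k, hk⟩ := exists_shift_of_homeomorph (integerCode_ne_univ B) hS h
    have hBC := eq_of_isLeast_of_shift (isLeast_integerCode B) (isLeast_integerCode C) hk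
    refine ⟨?_, hSC⟩
    rw [hSC, Function.comp_apply, hBC]
  · rintro _ ⟨B, rfl⟩
    have hG := isGδ_realGraph_oscillating (integerCode B)
    exact ⟨isConnected_realGraph_oscillating _, hG.isCompletelyMetrizableSpace, hG⟩
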